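/- Let $d\ge 1$ be an integer and $\beta\in(0,d]$. For $E\subset\mathbb R^d$ let $$\mathcal H^\beta_\infty(E)=\inf\Big\{\sum_{i=1}^\infty \omega_\beta r_i^\beta : E\subset\bigcup_{i=1}^\infty B(x_i,r_i)\Big\},\qquad \omega_\beta=\frac{\pi^{\beta/2}}{\Gamma(\beta/2+1)},$$ be the (spherical) Hausdorff content, and for $f\ge 0$ on $Q\subset\mathbb R^d$ let $\int_Q f\,d\mathcal H^\beta_\infty=\int_0^\infty \mathcal H^\beta_\infty(\{x\in Q: f(x)>t\})\,dt$ be the Choquet integral. Cubes are half-open, with edges parallel to the axes of an orthonormal frame; $l(Q)$ is the side length of a finite cube $Q$. Let $Q_0$ be a finite cube in $\mathbb R^d$ or $Q_0=\mathbb R^d$ (with a fixed orthonormal frame). A function $u:Q_0\to\mathbb R$ is in $L^1(Q_0;\mathcal H^\beta_\infty)$ if $\int_{Q_0}|u|\,d\mathcal H^\beta_\infty<\infty$ and $u$ is quasicontinuous, i.e. for every $\epsilon>0$ there is an open set $O$ with $\mathcal H^\beta_\infty(O)<\epsilon$ such that $u|_{Q_0\setminus O}$ is continuous. For $1\le p<\infty$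 put $$\|u\|_{BMO^{\beta,p}(Q_0)}=\sup_{Q\subset Q_0}\inf_{c\in\mathbb R}\Big(\frac1{l(Q)^\beta}\int_Q|u-c|^p\,d\mathcal H^\beta_\infty\Big)^{1/p},$$ where the supremum is over all finite subcubes $Q\subset Q_0$ parallel to $Q_0$, let $\|u\|_{BMO^\beta(Q_0)}=\|u\|_{BMO^{\beta,1}(Q_0)}$, and let $BMO^\beta(Q_0)$ be the set of all $u\in L^1(Q_0;\mathcal H^\beta_\infty)$ with $\|u\|_{BMO^\beta(Q_0)}<\infty$. Then there is a constant $C>0$, depending only on $d$ and $\beta$, such that $$\frac1C\,\|u\|_{BMO^\beta(Q_0)}\le\|u\|_{BMO^{\beta,p}(Q_0)}\le C\,p\,\|u\|_{BMO^\beta(Q_0)}$$ for every such $Q_0$, every $1\le p<\infty$ and every $u\in BMO^\beta(Q_0)$. -/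

import Mathlib

noncomputable section

namespace ChoquetBMO

open scoped ENNReal NNReal

/-- The ambient space `ℝ^d` with its Euclidean norm. -/
abbrev E (d : ℕ) : Type := EuclideanSpace ℝ (Fin d)

/-- The normalization constant `ω_β = π^(β/2) / Γ(β/2 + 1)`. -/
def omega (β : ℝ) : ℝ := Real.pi ^ (β / 2) / Real.Gamma (β / 2 + 1)

/-- The `β`-dimensional spherical Hausdorff content: the infimum of `∑ ω_β r_i^β` over all
sequences of balls that cover `A`. A radius `0` gives the empty ball and, for `β > 0`, costs `0`,
so that finite coverings are included. -/
def hausdorffContent {d : ℕ} (β : ℝ) (A : Set (E d)) : ℝ≥0∞ :=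
  ⨅ (x : ℕ → E d) (r : ℕ → ℝ≥0) (_ : A ⊆ ⋃ i, Metric.ball (x i) (r i : ℝ)),
    ∑' i, ENNReal.ofReal (omega β * (r i : ℝ) ^ β)

/-- The Choquet integral over `A` of a non-negative function `f` with respect to the
`β`-dimensional Hausdorff content. The integrand is monotone in `t`, hence measurable. -/
def choquetIntegral {d : ℕ} (β : ℝ) (A : Set (E d)) (f : E d → ℝ) : ℝ≥0∞ :=
  ∫⁻ t in Set.Ioi (0 : ℝ), hausdorffContent β {x ∈ A | t < f x}

/-- Quasicontinuity on `A` with respect to the `β`-dimensional Hausdorff content. -/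
def QuasiContinuousOn {d : ℕ} (β : ℝ) (A : Set (E d)) (f : E d → ℝ) : Prop :=
  ∀ ε : ℝ≥0∞, 0 < ε →
    ∃ O : Set (E d), IsOpen O ∧ hausdorffContent β O < ε ∧ ContinuousOn f (A \ O)

/-- Membership of `f`, restricted to `A`, in `L¹(A; H^β_∞)`. -/
def MemL1 {d : ℕ} (β : ℝ) (A : Set (E d)) (f : E d → ℝ) : Prop :=
  QuasiContinuousOn β A f ∧ choquetIntegral β A (fun x => |f x|) < ∞

/-- The half-open cube of side length `l` whose edges are parallel to the axes of the orthonormal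
frame `R`: in the coordinates of `R` it is the product of the intervals `[a i, a i + l)`.
Two cubes with the same `R` are parallel. -/
def cube {d : ℕ} (R : E d ≃ₗᵢ[ℝ] E d) (a : E d) (l : ℝ) : Set (E d) :=
  {x | ∀ i, (R x) i ∈ Set.Ico (a i) (a i + l)}

/-- `Q₀` is a cube parallel to the frame `R`: a finite one, or the infinite cube `ℝ^d`. -/
def IsCube {d : ℕ} (R : E d ≃ₗᵢ[ℝ] E d) (Q₀ : Set (E d)) : Prop :=
  (∃ (a : E d) (l : ℝ), 0 < l ∧ Q₀ = cube R a l) ∨ Q₀ = Set.univ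

/-- The seminorm of `BMO^β(Q₀)`: the supremum is over all finite subcubes `Q` of `Q₀`
parallel to the frame `R` of `Q₀`. -/
def bmoSeminorm {d : ℕ} (β : ℝ) (R : E d ≃ₗᵢ[ℝ] E d) (Q₀ : Set (E d)) (u : E d → ℝ) : ℝ≥0∞ :=
  ⨆ (a : E d) (l : ℝ) (_ : 0 < l) (_ : cube R a l ⊆ Q₀), ⨅ c : ℝ,
    choquetIntegral β (cube R a l) (fun x => |u x - c|) / ENNReal.ofReal (l ^ β)

/-- The seminorm of `BMO^{β,p}(Q₀)`. -/
def bmoSeminormP {d : ℕ} (β p : ℝ) (R : E d ≃ₗᵢ[ℝ] E d) (Q₀ : Set (E d)) (u : E d → ℝ) : ℝ≥0∞ :=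
  ⨆ (a : E d) (l : ℝ) (_ : 0 < l) (_ : cube R a l ⊆ Q₀), ⨅ c : ℝ,
    (choquetIntegral β (cube R a l) (fun x => |u x - c| ^ p) / ENNReal.ofReal (l ^ β)) ^ (1 / p)

/-- Membership in the space `BMO^β(Q₀)`. -/
def MemBMO {d : ℕ} (β : ℝ) (R : E d ≃ₗᵢ[ℝ] E d) (Q₀ : Set (E d)) (u : E d → ℝ) : Prop :=
  MemL1 β Q₀ u ∧ bmoSeminorm β R Q₀ u < ∞

end ChoquetBMO

end

/-! This is the John–Nirenberg argument, run with nothing but monotonicity and countable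
subadditivity of the content and its comparability with `l ^ β` on cubes. Attach to each subcube `Q`
a nearly optimal constant `c_Q`. By Chebyshev the bad set `A = {x ∈ Q : |u - c_Q| > B}` has content
at most `η l(Q)^β`, with `η` as small as desired once `B` is a large multiple of the seminorm.

Cover `A` by dyadic subcubes `P` with small `∑ l(P)^β`, arranged so that `A` fills only a small
fraction of each `P` (`exists_dyadic_cover`, `exists_sparse_cover`). Subadditivity and the lower
bound for the content of a cube (`le_hausdorffContent_cube`) then leave a point of `P` that is bad
for neither `Q` nor `P`, so `|c_P - c_Q| ≤ 2B`. Hence each rise of the level by `2B` halves the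
content (`exists_threshold_decay`). Integrating this exponential decay gives the factor `p`
(`choquetIntegral_rpow_le`).

The reverse inequality needs only a truncation of the Choquet integral in place of Hölder
(`choquetIntegral_le_rpow`). -/

noncomputable section

namespace ChoquetBMO

open scoped ENNReal NNReal
open MeasureTheory

/-! ### Coverings by the cells of a tree of partitions -/

section Tree

variable {X ι : Type} (idx : ℕ → X → ι)

/-- The cell of generation `s.1` with label `s.2`. -/
def cell (s : ℕ × ι) : Set X := {x | idx s.1 x = s.2}

/-- The partitions into cells refine one another. -/
def Nested : Prop := ∀ k x y, idx (k + 1) x = idx (k + 1) y → idx k x = idx k y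

variable {idx}

theorem Nested.of_le (h : Nested idx) {j k : ℕ} (hjk : j ≤ k) {x y : X}
    (hxy : idx k x = idx k y) : idx j x = idx j y := by
  induction k, hjk using Nat.le_induction with
  | base => exact hxy
  | succ k _ ih => exact ih (h k x y hxy)

variable (idx) in
/-- The cell of generation `k` containing `x`. -/
def lab (k : ℕ) (x : X) : ℕ × ι := (k, idx k x)

/-- A set covered by cells is covered by cells in which it has small relative content, at the
price of a constant factor: a cell of the covering is either kept or replaced by the parent of a
maximal cell of large relative content. -/
theorem exists_sparse_cover [Nonempty X] [Countable ι] (hn : Nested idx) (H : OuterMeasure X)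
    {w : ℕ → ℝ≥0∞} {C D K : ℝ≥0∞} (hw : ∀ k, w k ≤ D * w (k + 1))
    (hC : ∀ s, H (cell idx s) ≤ C * w s.1) {A : Set X} {S : Set (ℕ × ι)}
    (hS : A ⊆ ⋃ s ∈ S, cell idx s) (h0 : ∀ x ∈ A, K * H (A ∩ cell idx (lab idx 0 x)) < w 0) :
    ∃ (T : Type) (_ : Countable T) (g : T → ℕ × ι), A ⊆ ⋃ t, cell idx (g t) ∧
      (∀ t, (A ∩ cell idx (g t)).Nonempty ∧ K * H (A ∩ cell idx (g t)) < w (g t).1) ∧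
      ∑' t, w (g t).1 ≤ (1 + D * (K * C)) * ∑' s : S, w s.1.1 := by
  classical
  -- `M` consists of the maximal heavy cells with no proper ancestor in `S`; `G` of the light cells
  -- of `S` that meet `A`. The new covering is `G` together with the parents of `M`, which are light
  -- by maximality.
  set heavy : ℕ × ι → Prop := fun s => w s.1 ≤ K * H (A ∩ cell idx s)
  set M : Set (ℕ × ι) := {s | ∃ x ∈ A, s = lab idx s.1 x ∧ heavy s ∧
    (∀ j < s.1, ¬ heavy (lab idx j x)) ∧ ∀ j < s.1, lab idx j x ∉ S}
  set G : Set (ℕ × ι) := {s | s ∈ S ∧ ∃ x ∈ A, s = lab idx s.1 x ∧ ¬ heavy s}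
  choose! pt ptA ptl pth ptn ptS using fun (s : ℕ × ι) (hs : s ∈ M) => hs
  have hMpos : ∀ s ∈ M, 0 < s.1 := by
    intro s hs
    by_contra h
    have h1 := pth s hs
    have h2 := ptl s hs
    rw [h2] at h1
    have h3 : s.1 = 0 := by omega
    rw [h3] at h1
    exact (h0 _ (ptA s hs)).not_ge h1
  have hMdisj : ∀ s ∈ M, ∀ s' ∈ M, ∀ y, lab idx s.1 y = s → lab idx s'.1 y = s' →
      s.1 ≤ s'.1 → s = s' := by
    intro s hs s' hs' y hy hy' hle
    rcases hle.eq_or_lt with h | h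
    · rw [← hy, ← hy', h]
    · exfalso
      have h1 := ptn s' hs' s.1 h
      have h2 : idx s'.1 y = idx s'.1 (pt s') := by
        have := hy'.trans (ptl s' hs')
        exact congrArg Prod.snd this
      have h3 : lab idx s.1 (pt s') = s := by
        rw [← hy]; simp only [lab]; rw [hn.of_le h.le h2]
      rw [h3] at h1
      exact h1 (pth s hs)
  let below : ℕ × ι → ℕ × ι → Prop := fun σ s => s.1 ≤ σ.1 ∧ ∃ y, lab idx σ.1 y = σ ∧
    lab idx s.1 y = s
  have hbelow : ∀ σ, ∀ s ∈ M, ∀ s' ∈ M, below σ s → below σ s' → s = s' := by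
    have key : ∀ σ, ∀ s ∈ M, ∀ s' ∈ M, below σ s → below σ s' → s.1 ≤ s'.1 → s = s' := by
      rintro σ s hs s' hs' ⟨h1, y, hy, hy1⟩ ⟨h2, z, hz, hz1⟩ hle
      have h3 : idx σ.1 y = idx σ.1 z := congrArg Prod.snd (hy.trans hz.symm)
      refine hMdisj s hs s' hs' y hy1 ?_ hle
      rw [← hz1]; simp only [lab]; rw [hn.of_le h2 h3]
    intro σ s hs s' hs' h h'
    rcases le_total s.1 s'.1 with hle | hle
    · exact key σ s hs s' hs' h h' hle
    · exact (key σ s' hs' s hs h' h hle).symm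
  -- No proper ancestor of `s` lies in `S`, so the members of `S` that cover `A ∩ cell idx s` lie
  -- inside `s` and pay for its weight.
  have hMw : ∀ s ∈ M, w s.1 ≤ K * C * ∑' σ : S, if below σ s then w σ.1.1 else 0 := by
    intro s hs
    have hsub : A ∩ cell idx s ⊆ ⋃ σ : S, if below σ s then cell idx σ else ∅ := by
      rintro y ⟨hyA, hys⟩
      have hys' : lab idx s.1 y = s := Prod.ext rfl hys
      obtain ⟨σ, hσ, hyσ⟩ := Set.mem_iUnion₂.1 (hS hyA)
      have hyσ' : lab idx σ.1 y = σ := Prod.ext rfl hyσ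
      have hle : s.1 ≤ σ.1 := by
        by_contra h
        push Not at h
        have h2 : idx s.1 y = idx s.1 (pt s) := congrArg Prod.snd (hys'.trans (ptl s hs))
        have h3 : lab idx σ.1 (pt s) = σ := by
          rw [← hyσ']; simp only [lab]; rw [hn.of_le h.le h2]
        exact ptS s hs σ.1 h (h3 ▸ hσ)
      refine Set.mem_iUnion.2 ⟨⟨σ, hσ⟩, ?_⟩
      rw [if_pos ⟨hle, y, hyσ', hys'⟩]
      exact hyσ
    calc w s.1 ≤ K * H (A ∩ cell idx s) := pth s hs
      _ ≤ K * ∑' σ : S, C * if below σ s then w σ.1.1 else 0 := by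
        gcongr
        refine (measure_mono hsub).trans ((measure_iUnion_le _).trans ?_)
        refine ENNReal.tsum_le_tsum fun σ => ?_
        split_ifs
        · exact hC _
        · simp
      _ = _ := by rw [ENNReal.tsum_mul_left, mul_assoc]
  -- The truncated subtraction `s.1.1 - 1` is a true predecessor by `hMpos`. A parent may be listed
  -- several times; the estimate counts it once for each child in `M`.
  refine ⟨G ⊕ M, inferInstance,
    Sum.elim (fun s => s.1) (fun s => lab idx (s.1.1 - 1) (pt s.1)), ?_, ?_, ?_⟩
  · intro x hx
    have inG : ∀ σ ∈ S, x ∈ cell idx σ → ¬ heavy σ → x ∈ ⋃ t : G ⊕ M, cell idx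
        (Sum.elim (fun s => s.1) (fun s => lab idx (s.1.1 - 1) (pt s.1)) t) := fun σ hσ hxσ hh =>
      Set.mem_iUnion.2 ⟨Sum.inl ⟨σ, hσ, x, hx, (Prod.ext rfl hxσ : lab idx σ.1 x = σ).symm, hh⟩,
        hxσ⟩
    by_cases hex : ∃ k, heavy (lab idx k x)
    · have hk := Nat.find_spec hex
      have hmin : ∀ j < Nat.find hex, ¬ heavy (lab idx j x) := fun j hj => Nat.find_min hex hj
      set k := Nat.find hex
      by_cases hjS : ∀ j < k, lab idx j x ∉ S
      · have hm : lab idx k x ∈ M := ⟨x, hx, rfl, hk, hmin, hjS⟩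
        refine Set.mem_iUnion.2 ⟨Sum.inr ⟨_, hm⟩, ?_⟩
        have h2 : idx k x = idx k (pt (lab idx k x)) := congrArg Prod.snd (ptl _ hm)
        exact hn.of_le (Nat.sub_le k 1) h2
      · push Not at hjS
        obtain ⟨j, hj, hjS⟩ := hjS
        exact inG _ hjS rfl (hmin j hj)
    · push Not at hex
      obtain ⟨σ, hσ, hxσ⟩ := Set.mem_iUnion₂.1 (hS hx)
      refine inG σ hσ hxσ ?_
      have := hex σ.1
      rwa [(Prod.ext rfl hxσ : lab idx σ.1 x = σ)] at this
  · rintro (⟨s, hs, x, hx, hsx, hh⟩ | ⟨s, hs⟩)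
    · exact ⟨⟨x, hx, (congrArg Prod.snd hsx).symm⟩, not_le.1 hh⟩
    · have := hMpos s hs
      exact ⟨⟨pt s, ptA s hs, rfl⟩, not_le.1 (ptn s hs (s.1 - 1) (by omega))⟩
  · rw [Summable.tsum_sum ENNReal.summable ENNReal.summable, add_mul, one_mul]
    refine add_le_add ?_ ?_
    · exact ENNReal.tsum_mono_subtype (fun s : ℕ × ι => w s.1) (fun s hs => hs.1)
    · calc ∑' s : M, w (s.1.1 - 1) ≤ ∑' s : M, D * (K * C *
            ∑' σ : S, if below σ s then w σ.1.1 else 0) := by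
            refine ENNReal.tsum_le_tsum fun s => ?_
            have h1 := hw (s.1.1 - 1)
            rw [Nat.sub_add_cancel (hMpos s.1 s.2)] at h1
            exact h1.trans (by gcongr; exact hMw s.1 s.2)
        _ = D * (K * C) * ∑' σ : S, ∑' s : M, if below σ s then w σ.1.1 else 0 := by
            rw [ENNReal.tsum_mul_left, ENNReal.tsum_mul_left, ENNReal.tsum_comm]
            simp only [mul_assoc]
        -- Distinct cells of `M` are disjoint, so each `σ` is charged at most once.
        _ ≤ _ := by
            gcongr with σ
            by_cases hb : ∃ s : M, below σ s
            · obtain ⟨s, hs⟩ := hb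
              rw [tsum_eq_single s]
              · split_ifs
                exact le_rfl
              · intro s' hs'
                rw [if_neg]
                intro hb'
                exact hs' (Subtype.ext (hbelow σ s' s'.2 s s.2 hb' hs))
            · push Not at hb
              simp [hb]

end Tree

variable {d : ℕ} {β : ℝ}

/-! ### The Hausdorff content -/

theorem omega_pos (hβ : 0 < β) : 0 < omega β :=
  div_pos (Real.rpow_pos_of_pos Real.pi_pos _) (Real.Gamma_pos_of_pos (by linarith))

theorem hausdorffContent_le {A : Set (E d)} (x : ℕ → E d) (r : ℕ → ℝ≥0)
    (h : A ⊆ ⋃ i, Metric.ball (x i) (r i : ℝ)) :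
    hausdorffContent β A ≤ ∑' i, ENNReal.ofReal (omega β * (r i : ℝ) ^ β) :=
  iInf_le_of_le x (iInf_le_of_le r (iInf_le_of_le h le_rfl))

theorem exists_cover_of_lt {A : Set (E d)} {b : ℝ≥0∞} (h : hausdorffContent β A < b) :
    ∃ (x : ℕ → E d) (r : ℕ → ℝ≥0), A ⊆ ⋃ i, Metric.ball (x i) (r i : ℝ) ∧
      ∑' i, ENNReal.ofReal (omega β * (r i : ℝ) ^ β) < b := by
  simp only [hausdorffContent, iInf_lt_iff] at h
  obtain ⟨x, r, h1, h2⟩ := h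
  exact ⟨x, r, h1, h2⟩

theorem hausdorffContent_mono {A B : Set (E d)} (h : A ⊆ B) :
    hausdorffContent β A ≤ hausdorffContent β B :=
  le_iInf fun x => le_iInf fun r => le_iInf fun hB => hausdorffContent_le x r (h.trans hB)

theorem hausdorffContent_empty (hβ : 0 < β) : hausdorffContent β (∅ : Set (E d)) = 0 := by
  refine le_antisymm ((hausdorffContent_le (fun _ => 0) (fun _ => 0) (Set.empty_subset _)).trans ?_)
    zero_le
  simp [Real.zero_rpow hβ.ne']

theorem hausdorffContent_iUnion_le (A : ℕ → Set (E d)) :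
    hausdorffContent β (⋃ i, A i) ≤ ∑' i, hausdorffContent β (A i) := by
  refine ENNReal.le_of_forall_pos_le_add fun ε hε hfin => ?_
  obtain ⟨δ, hδ, hδs⟩ := ENNReal.exists_pos_sum_of_countable'
    (ENNReal.coe_pos.2 hε).ne' ℕ
  have hlt : ∀ i, hausdorffContent β (A i) < hausdorffContent β (A i) + δ i := fun i =>
    ENNReal.lt_add_right (ne_top_of_le_ne_top hfin.ne (ENNReal.le_tsum i)) (hδ i).ne'
  choose x r hc hs using fun i => exists_cover_of_lt (hlt i)
  refine (hausdorffContent_le (fun n => x n.unpair.1 n.unpair.2)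
    (fun n => r n.unpair.1 n.unpair.2) ?_).trans ?_
  · refine Set.iUnion_subset fun i y hy => ?_
    obtain ⟨j, hj⟩ := Set.mem_iUnion.1 (hc i hy)
    exact Set.mem_iUnion.2 ⟨Nat.pair i j, by simpa using hj⟩
  · calc ∑' n : ℕ, ENNReal.ofReal (omega β * (r n.unpair.1 n.unpair.2 : ℝ) ^ β)
        = ∑' p : ℕ × ℕ, ENNReal.ofReal (omega β * (r p.1 p.2 : ℝ) ^ β) :=
          Nat.pairEquiv.symm.tsum_eq
            (fun p : ℕ × ℕ => ENNReal.ofReal (omega β * (r p.1 p.2 : ℝ) ^ β))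
      _ = ∑' i, ∑' j, ENNReal.ofReal (omega β * (r i j : ℝ) ^ β) := ENNReal.tsum_prod
            (f := fun i j => ENNReal.ofReal (omega β * (r i j : ℝ) ^ β))
      _ ≤ ∑' i, (hausdorffContent β (A i) + δ i) := ENNReal.tsum_le_tsum fun i => (hs i).le
      _ = ∑' i, hausdorffContent β (A i) + ∑' i, δ i := ENNReal.tsum_add
      _ ≤ _ := by gcongr

/-- The Hausdorff content as an outer measure. -/
def contentOuter (d : ℕ) (hβ : 0 < β) : OuterMeasure (E d) where
  measureOf := hausdorffContent β
  empty := hausdorffContent_empty hβ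
  mono := hausdorffContent_mono
  iUnion_nat := fun s _ => hausdorffContent_iUnion_le s

theorem contentOuter_apply (hβ : 0 < β) (A : Set (E d)) :
    contentOuter d hβ A = hausdorffContent β A := rfl

theorem hausdorffContent_ball_le (hβ : 0 < β) (x : E d) (r : ℝ≥0) :
    hausdorffContent β (Metric.ball x r) ≤ ENNReal.ofReal (omega β * (r : ℝ) ^ β) := by
  refine (hausdorffContent_le (fun _ => x) (fun i => if i = 0 then r else 0) ?_).trans ?_
  · exact fun y hy => Set.mem_iUnion.2 ⟨0, by simpa using hy⟩
  · rw [tsum_eq_single 0]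
    · simp
    · intro i hi
      simp [hi, Real.zero_rpow hβ.ne']

theorem dist_le_of_coords (R : E d ≃ₗᵢ[ℝ] E d) {x y : E d} {l : ℝ}
    (h : ∀ i, |(R x) i - (R y) i| ≤ l) : dist x y ≤ d * l := by
  rw [← R.dist_map, dist_eq_norm, EuclideanSpace.norm_eq]
  refine Real.sqrt_le_iff.2 ⟨?_, ?_⟩
  · rcases Nat.eq_zero_or_pos d with rfl | hd
    · simp
    · exact mul_nonneg (Nat.cast_nonneg _) ((abs_nonneg _).trans (h ⟨0, hd⟩))
  · calc ∑ i, ‖(R x - R y) i‖ ^ 2 ≤ ∑ i : Fin d, l ^ 2 := by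
          refine Finset.sum_le_sum fun i _ => ?_
          have := h i
          simp only [PiLp.sub_apply, Real.norm_eq_abs]
          gcongr
      _ = d * l ^ 2 := by simp
      _ ≤ d * (d * l ^ 2) := by
          rcases Nat.eq_zero_or_pos d with rfl | hd
          · simp
          · have : (1 : ℝ) ≤ d := by exact_mod_cast hd
            nlinarith [mul_nonneg (Nat.cast_nonneg (α := ℝ) d) (sq_nonneg l)]
      _ = (d * l) ^ 2 := by ring

theorem hausdorffContent_cube_le (hβ : 0 < β) (R : E d ≃ₗᵢ[ℝ] E d) (a : E d) {l : ℝ}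
    (hl : 0 < l) :
    hausdorffContent β (cube R a l) ≤
      ENNReal.ofReal (omega β * (d + 1) ^ β) * ENNReal.ofReal (l ^ β) := by
  -- The factor `d + 1` instead of `d` leaves room for the strict inequality of an open ball.
  have hsub : cube R a l ⊆ Metric.ball (R.symm a) (((d + 1) * l).toNNReal : ℝ≥0) := by
    intro x hx
    rw [Metric.mem_ball, Real.coe_toNNReal _ (by positivity)]
    have : dist x (R.symm a) ≤ d * l := by
      refine dist_le_of_coords R fun i => ?_
      have := hx i
      rw [Set.mem_Ico] at this
      rw [R.apply_symm_apply, abs_le]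
      constructor <;> linarith
    linarith
  refine (hausdorffContent_mono hsub).trans ((hausdorffContent_ball_le hβ _ _).trans ?_)
  have := (omega_pos hβ).le
  rw [← ENNReal.ofReal_mul (by positivity), Real.coe_toNNReal _ (by positivity),
    Real.mul_rpow (by positivity) hl.le, mul_assoc]

/-- A covering ball of radius above `l` already costs enough. If all radii are at most `l`, then `r
^ d ≤ l ^ (d - β) * r ^ β` because `β ≤ d`, and comparing the Lebesgue volume of the inscribed ball
with that of the covering balls bounds the cost from below. -/
theorem le_hausdorffContent_cube (hd : 0 < d) (hβ : 0 < β) (hβd : β ≤ d) (R : E d ≃ₗᵢ[ℝ] E d)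
    (a : E d) {l : ℝ} (hl : 0 < l) :
    ENNReal.ofReal (omega β / 2 ^ d) * ENNReal.ofReal (l ^ β) ≤
      hausdorffContent β (cube R a l) := by
  have hω := omega_pos hβ
  have hlβ : 0 < l ^ β := Real.rpow_pos_of_pos hl _
  rw [← ENNReal.ofReal_mul (by positivity)]
  refine le_iInf fun x => le_iInf fun r => le_iInf fun hc => ?_
  by_cases hr : ∃ i, l < r i
  · obtain ⟨i, hi⟩ := hr
    refine le_trans ?_ (ENNReal.le_tsum i)
    refine ENNReal.ofReal_le_ofReal ?_
    have h1 : l ^ β ≤ (r i : ℝ) ^ β := Real.rpow_le_rpow hl.le hi.le hβ.le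
    have h2 : omega β / 2 ^ d ≤ omega β := div_le_self hω.le (one_le_pow₀ (by norm_num))
    exact mul_le_mul h2 h1 hlβ.le hω.le
  · push Not at hr
    have : Nonempty (Fin d) := ⟨⟨0, hd⟩⟩
    set v : ℝ≥0∞ := volume (Metric.ball (0 : E d) 1)
    have hv0 : v ≠ 0 := (Metric.measure_ball_pos _ _ one_pos).ne'
    have hvt : v ≠ ∞ := measure_ball_lt_top.ne
    set z : E d := R.symm (WithLp.toLp 2 fun i => a i + l / 2) with hz
    have hball : Metric.ball z (l / 2) ⊆ cube R a l := by
      intro y hy i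
      have h1 : ‖R y - R z‖ < l / 2 := by
        rw [← dist_eq_norm, R.dist_map]; exact hy
      have h2 : |(R y) i - (a i + l / 2)| < l / 2 := by
        refine lt_of_le_of_lt ?_ h1
        have := PiLp.norm_apply_le (R y - R z) i
        rw [hz, R.apply_symm_apply, PiLp.sub_apply, Real.norm_eq_abs] at this
        rwa [hz, R.apply_symm_apply]
      rw [abs_lt] at h2
      exact ⟨by linarith, by linarith⟩
    have hvol : ENNReal.ofReal ((l / 2) ^ d) * v ≤
        ∑' i, ENNReal.ofReal ((r i : ℝ) ^ d) * v := by
      have h1 := Measure.addHaar_ball (volume : Measure (E d)) z (r := l / 2) (by positivity)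
      rw [finrank_euclideanSpace_fin] at h1
      rw [← h1]
      refine (measure_mono (hball.trans hc)).trans ((measure_iUnion_le _).trans ?_)
      refine ENNReal.tsum_le_tsum fun i => ?_
      have h2 := Measure.addHaar_ball (volume : Measure (E d)) (x i) (r i).coe_nonneg
      rw [finrank_euclideanSpace_fin] at h2
      exact h2.le
    rw [ENNReal.tsum_mul_right, ENNReal.mul_le_mul_iff_left hv0 hvt] at hvol
    have hpow : ∀ i, ENNReal.ofReal ((r i : ℝ) ^ d) ≤ ENNReal.ofReal (l ^ (d - β) / omega β) *
        ENNReal.ofReal (omega β * (r i : ℝ) ^ β) := by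
      intro i
      have : 0 ≤ l ^ (d - β) := Real.rpow_nonneg hl.le _
      rw [← ENNReal.ofReal_mul (by positivity)]
      refine ENNReal.ofReal_le_ofReal ?_
      have h1 : l ^ (d - β) / omega β * (omega β * (r i : ℝ) ^ β) = l ^ (d - β) * (r i : ℝ) ^ β := by
        field_simp
      rw [h1]
      rcases (r i).coe_nonneg.eq_or_lt with h0 | h0
      · rw [← h0, zero_pow hd.ne', Real.zero_rpow hβ.ne', mul_zero]
      · calc (r i : ℝ) ^ d = (r i : ℝ) ^ ((d - β) + β) := by simp
          _ = (r i : ℝ) ^ (d - β) * (r i : ℝ) ^ β := Real.rpow_add h0 _ _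
          _ ≤ _ := by
            exact mul_le_mul_of_nonneg_right
              (Real.rpow_le_rpow h0.le (hr i) (by linarith)) (by positivity)
    have h3 := hvol.trans (ENNReal.tsum_le_tsum hpow)
    rw [ENNReal.tsum_mul_left] at h3
    calc ENNReal.ofReal (omega β / 2 ^ d * l ^ β)
        = ENNReal.ofReal (omega β / l ^ (d - β)) * ENNReal.ofReal ((l / 2) ^ d) := by
          have : 0 ≤ l ^ (d - β) := Real.rpow_nonneg hl.le _
          rw [← ENNReal.ofReal_mul (by positivity)]
          congr 1
          have h4 : l ^ d = l ^ (d - β) * l ^ β := by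
            rw [← Real.rpow_add hl]; simp
          rw [div_pow, h4]
          have : l ^ (d - β) ≠ 0 := (Real.rpow_pos_of_pos hl _).ne'
          field_simp
      _ ≤ ENNReal.ofReal (omega β / l ^ (d - β)) * (ENNReal.ofReal (l ^ (d - β) / omega β) *
          ∑' i, ENNReal.ofReal (omega β * (r i : ℝ) ^ β)) := by gcongr
      _ = _ := by
          have h5 : 0 < l ^ (d - β) := Real.rpow_pos_of_pos hl _
          rw [← mul_assoc, ← ENNReal.ofReal_mul (by positivity)]
          have : omega β / l ^ (d - β) * (l ^ (d - β) / omega β) = 1 := by field_simp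
          rw [this]; simp

/-! ### Dyadic subcubes -/

section Dyadic

variable (R : E d ≃ₗᵢ[ℝ] E d) (a : E d) (l : ℝ)

/-- The label of the dyadic subcube of generation `k` of `cube R a l` that contains `x`. -/
def dyadicIndex (k : ℕ) (x : E d) : Fin d → ℤ := fun i => ⌊2 ^ k * (((R x) i - a i) / l)⌋

/-- The corner of a dyadic subcube of `cube R a l`. -/
def dyadicCorner (s : ℕ × (Fin d → ℤ)) : E d :=
  WithLp.toLp 2 fun i => a i + l / 2 ^ s.1 * s.2 i

variable {l}

theorem nested_dyadicIndex : Nested (dyadicIndex R a l) := by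
  intro k x y h
  funext i
  have hi := congrFun h i
  simp only [dyadicIndex, pow_succ] at hi ⊢
  generalize ((R x) i - a i) / l = p at hi ⊢
  generalize ((R y) i - a i) / l = q at hi ⊢
  -- The coarser label is the integer half of the finer one.
  have key : ∀ z : ℝ, ⌊(2 : ℝ) ^ k * z⌋ = ⌊(2 : ℝ) ^ k * 2 * z⌋ / 2 := by
    intro z
    rw [mul_right_comm]
    generalize (2 : ℝ) ^ k * z = v
    have h1 := Int.floor_le (v * 2)
    have h2 := Int.lt_floor_add_one (v * 2)
    have h3 : (⌊v * 2⌋ / 2) * 2 ≤ ⌊v * 2⌋ := by omega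
    have h4 : ⌊v * 2⌋ + 1 ≤ (⌊v * 2⌋ / 2) * 2 + 2 := by omega
    rw [Int.floor_eq_iff]
    have h3' : ((⌊v * 2⌋ / 2 : ℤ) : ℝ) * 2 ≤ ⌊v * 2⌋ := by exact_mod_cast h3
    have h4' : (⌊v * 2⌋ : ℝ) + 1 ≤ ((⌊v * 2⌋ / 2 : ℤ) : ℝ) * 2 + 2 := by exact_mod_cast h4
    constructor <;> linarith
  rw [key, key, hi]

theorem cell_dyadicIndex (hl : 0 < l) (s : ℕ × (Fin d → ℤ)) :
    cell (dyadicIndex R a l) s = cube R (dyadicCorner a l s) (l / 2 ^ s.1) := by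
  ext x
  simp only [cell, cube, Set.mem_ofPred_eq, dyadicCorner, Set.mem_Ico, dyadicIndex, funext_iff]
  refine forall_congr' fun i => ?_
  rw [Int.floor_eq_iff]
  have h2 : (0 : ℝ) < 2 ^ s.1 := by positivity
  have e : (2 : ℝ) ^ s.1 * (((R x) i - a i) / l) = ((R x) i - a i) / (l / 2 ^ s.1) := by
    field_simp
  have h3 : 0 < l / 2 ^ s.1 := by positivity
  rw [e, le_div_iff₀ h3, div_lt_iff₀ h3]
  constructor <;> rintro ⟨h4, h5⟩ <;> constructor <;> linarith

theorem cell_dyadicIndex_zero (hl : 0 < l) :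
    cell (dyadicIndex R a l) (0, 0) = cube R a l := by
  rw [cell_dyadicIndex R a hl]
  simp only [dyadicCorner, pow_zero, div_one, Pi.zero_apply, Int.cast_zero, mul_zero, add_zero]

theorem dyadicIndex_zero_of_mem (hl : 0 < l) {x : E d} (hx : x ∈ cube R a l) :
    dyadicIndex R a l 0 x = 0 := by
  rw [← cell_dyadicIndex_zero R a hl] at hx; exact hx

theorem cell_subset_of_nonempty (hl : 0 < l) {s : ℕ × (Fin d → ℤ)}
    (h : (cube R a l ∩ cell (dyadicIndex R a l) s).Nonempty) :
    cell (dyadicIndex R a l) s ⊆ cube R a l := by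
  obtain ⟨x, hx, hxs⟩ := h
  intro y hy
  rw [← cell_dyadicIndex_zero R a hl]
  have : dyadicIndex R a l s.1 y = dyadicIndex R a l s.1 x := Eq.trans hy (Eq.symm hxs)
  exact ((nested_dyadicIndex R a).of_le (Nat.zero_le _) this).trans
    (dyadicIndex_zero_of_mem R a hl hx)

theorem exists_dyadic_cover (hβ : 0 < β) (hl : 0 < l) {A : Set (E d)} {b : ℝ≥0∞}
    (hA : hausdorffContent β A < b) (hb : b ≤ ENNReal.ofReal (omega β * (l / 4) ^ β)) :
    ∃ S : Set (ℕ × (Fin d → ℤ)), A ⊆ ⋃ s ∈ S, cell (dyadicIndex R a l) s ∧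
      ∑' s : S, ENNReal.ofReal ((l / 2 ^ s.1.1) ^ β) ≤
        ENNReal.ofReal (3 ^ d * (4 ^ β / omega β)) * b := by
  have hω := omega_pos hβ
  obtain ⟨x, r, hc, hs⟩ := exists_cover_of_lt hA
  -- The bound on `b` keeps every ball small against `l`, so a generation `k ≥ 0` of matching scale
  -- exists.
  have hr : ∀ i, (r i : ℝ) < l / 4 := by
    intro i
    by_contra h
    push Not at h
    refine (lt_of_le_of_lt ((ENNReal.le_tsum i).trans' ?_) hs).not_ge hb
    refine ENNReal.ofReal_le_ofReal ?_
    gcongr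
  set J : Set ℕ := {i | (A ∩ Metric.ball (x i) (r i)).Nonempty}
  have hJr : ∀ i ∈ J, 0 < (r i : ℝ) := fun i hi =>
    Metric.nonempty_ball.1 (hi.mono Set.inter_subset_right)
  have hk : ∀ i : J, ∃ k : ℕ, 2 * (r i : ℝ) ≤ l / 2 ^ k ∧ l / 2 ^ k ≤ 4 * r i := by
    intro i
    have h0 := hJr i i.2
    have h1 := hr i
    obtain ⟨n, h2, h3⟩ := exists_nat_pow_near_of_lt_one (x := 2 * (r i : ℝ) / l) (y := 1 / 2)
      (by positivity) (by rw [div_le_one hl]; linarith) (by norm_num) (by norm_num)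
    rw [lt_div_iff₀ hl] at h2
    rw [div_le_iff₀ hl] at h3
    refine ⟨n, h3.trans_eq (by rw [one_div, inv_pow]; ring), ?_⟩
    have : l / 2 ^ n = (1 / 2) ^ (n + 1) * l * 2 := by
      rw [pow_succ]; field_simp; simp
    linarith
  choose k hk1 hk2 using hk
  choose y hyA hyb using fun i : J => i.2
  -- A ball of diameter at most the side of the cells meets only the cell of `y` and its neighbours:
  -- offsets `-1, 0, 1` in each coordinate, hence the factor `3 ^ d`.
  let f : J × (Fin d → Fin 3) → ℕ × (Fin d → ℤ) := fun p =>
    (k p.1, fun i => dyadicIndex R a l (k p.1) (y p.1) i + (p.2 i : ℕ) - 1)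
  refine ⟨⋃ p, {f p}, ?_, ?_⟩
  · intro z hz
    obtain ⟨i, hi⟩ := Set.mem_iUnion.1 (hc hz)
    have hiJ : i ∈ J := ⟨z, hz, hi⟩
    set i' : J := ⟨i, hiJ⟩
    have hdist : dist (R z) (R (y i')) < 2 * r i := by
      rw [R.dist_map]
      have h1 : dist z (x i) < r i := hi
      have h2 : dist (y i') (x i) < r i := hyb i'
      have := dist_triangle_right z (y i') (x i)
      linarith
    have hfl : ∀ j, |dyadicIndex R a l (k i') z j - dyadicIndex R a l (k i') (y i') j| ≤ 1 := by
      intro j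
      have h1 : |(R z) j - (R (y i')) j| < l / 2 ^ k i' := by
        have := PiLp.norm_apply_le (R z - R (y i')) j
        rw [PiLp.sub_apply, Real.norm_eq_abs] at this
        rw [dist_eq_norm] at hdist
        exact (this.trans_lt hdist).trans_le (hk1 i')
      have h2 : (2 : ℝ) ^ k i' * (((R z) j - a j) / l) =
          ((R z) j - (R (y i')) j) / (l / 2 ^ k i') +
            (2 : ℝ) ^ k i' * (((R (y i')) j - a j) / l) := by
        field_simp; ring
      have h3 : 0 < l / 2 ^ k i' := by positivity
      rw [abs_lt] at h1
      have h4 : ((R z) j - (R (y i')) j) / (l / 2 ^ k i') < 1 := by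
        rw [div_lt_one h3]; exact h1.2
      have h5 : -1 < ((R z) j - (R (y i')) j) / (l / 2 ^ k i') := by
        rw [lt_div_iff₀ h3]; linarith [h1.1]
      simp only [dyadicIndex]
      rw [h2]
      generalize ((R z) j - (R (y i')) j) / (l / 2 ^ k i') = p at h4 h5
      generalize (2 : ℝ) ^ k i' * (((R (y i')) j - a j) / l) = q
      have e1 := Int.floor_le q
      have e2 := Int.lt_floor_add_one q
      have h6 : ⌊p + q⌋ < ⌊q⌋ + 2 := by rw [Int.floor_lt]; push_cast; linarith
      have h7 : ⌊q⌋ - 1 ≤ ⌊p + q⌋ := by rw [Int.le_floor]; push_cast; linarith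
      rw [abs_le]; constructor <;> omega
    have he : ∀ j, ∃ e : Fin 3, dyadicIndex R a l (k i') z j =
        dyadicIndex R a l (k i') (y i') j + (e : ℕ) - 1 := by
      intro j
      have := abs_le.1 (hfl j)
      refine ⟨⟨(dyadicIndex R a l (k i') z j - dyadicIndex R a l (k i') (y i') j + 1).toNat,
        by omega⟩, ?_⟩
      simp only
      omega
    choose e he using he
    refine Set.mem_iUnion₂.2 ⟨f (i', e), Set.mem_iUnion.2 ⟨(i', e), rfl⟩, ?_⟩
    exact funext he
  · calc ∑' s : (⋃ p, {f p} : Set (ℕ × (Fin d → ℤ))), ENNReal.ofReal ((l / 2 ^ s.1.1) ^ β)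
        ≤ ∑' p, ∑' s : ({f p} : Set (ℕ × (Fin d → ℤ))), ENNReal.ofReal ((l / 2 ^ s.1.1) ^ β) :=
          ENNReal.tsum_iUnion_le_tsum
            (fun s : ℕ × (Fin d → ℤ) => ENNReal.ofReal ((l / 2 ^ s.1) ^ β)) _
      _ = ∑' p, ENNReal.ofReal ((l / 2 ^ (f p).1) ^ β) := by
          refine tsum_congr fun p => ?_
          exact tsum_singleton (f p) (fun s : ℕ × (Fin d → ℤ) => ENNReal.ofReal ((l / 2 ^ s.1) ^ β))
      _ = ∑' i : J, ∑' _ : Fin d → Fin 3, ENNReal.ofReal ((l / 2 ^ k i) ^ β) :=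
          ENNReal.tsum_prod (f := fun (i : J) (_ : Fin d → Fin 3) =>
            ENNReal.ofReal ((l / 2 ^ k i) ^ β))
      _ ≤ ∑' i : J, ENNReal.ofReal (3 ^ d * (4 ^ β / omega β)) *
            ENNReal.ofReal (omega β * (r i : ℝ) ^ β) := by
          refine ENNReal.tsum_le_tsum fun i => ?_
          rw [tsum_fintype, Finset.sum_const, Finset.card_univ, nsmul_eq_mul]
          rw [← ENNReal.ofReal_mul (by positivity), ← ENNReal.ofReal_natCast,
            ← ENNReal.ofReal_mul (by positivity)]
          refine ENNReal.ofReal_le_ofReal ?_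
          have h1 : (l / 2 ^ k i) ^ β ≤ 4 ^ β * (r i : ℝ) ^ β := by
            rw [← Real.mul_rpow (by norm_num) (r i).coe_nonneg]
            exact Real.rpow_le_rpow (by positivity) (hk2 i) hβ.le
          have h2 : (3 : ℝ) ^ d * (4 ^ β / omega β) * (omega β * (r i : ℝ) ^ β) =
              3 ^ d * (4 ^ β * (r i : ℝ) ^ β) := by field_simp
          rw [h2]
          simp only [Fintype.card_pi, Fintype.card_fin, Finset.prod_const, Finset.card_univ]
          push_cast
          gcongr
      _ ≤ _ := by
          rw [ENNReal.tsum_mul_left]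
          gcongr
          exact (ENNReal.tsum_comp_le_tsum_of_injective Subtype.val_injective
            (fun i => ENNReal.ofReal (omega β * (r i : ℝ) ^ β))).trans hs.le

end Dyadic

/-! ### The good-λ inequality -/

/-- A small threshold for the relative content of the set where a function is far from its
constant on a cube forces exponential decay of the content of the upper level sets. -/
theorem exists_threshold_decay (hd : 0 < d) (hβ : 0 < β) (hβd : β ≤ d) :
    ∃ η : ℝ, 0 < η ∧ ∀ (R : E d ≃ₗᵢ[ℝ] E d) (Q₀ : Set (E d)) (u : E d → ℝ) (B : ℝ), 0 < B →
      ∀ c : E d → ℝ → ℝ,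
      (∀ a l, 0 < l → cube R a l ⊆ Q₀ →
        hausdorffContent β {x ∈ cube R a l | B < |u x - c a l|} ≤
          ENNReal.ofReal η * ENNReal.ofReal (l ^ β)) →
      ∀ (k : ℕ) a l, 0 < l → cube R a l ⊆ Q₀ →
        hausdorffContent β {x ∈ cube R a l | 2 * B * k < |u x - c a l|} ≤
          ENNReal.ofReal (omega β * (d + 1) ^ β) * (ENNReal.ofReal (1 / 2) ^ k *
            ENNReal.ofReal (l ^ β)) := by
  have hω := omega_pos hβ
  set c₀ : ℝ := omega β / 2 ^ d with hc₀
  have hc₀p : 0 < c₀ := by positivity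
  set C₂ : ℝ := omega β * (d + 1) ^ β with hC₂
  have hC₂p : 0 < C₂ := by positivity
  set N : ℝ := (1 + 2 ^ β * (2 / c₀ * C₂)) * (3 ^ d * (4 ^ β / omega β)) with hN
  have hNp : 0 < N := by positivity
  -- The first bound makes the root cell light and leaves `c₀ / 2 + η < c₀` in `hclose`; the second
  -- makes the balls small enough for `exists_dyadic_cover`; the third makes the total weight of the
  -- new cells at most half of `l ^ β`.
  set η : ℝ := min (c₀ / 4) (min (omega β / (2 * 4 ^ β)) (1 / (4 * N))) with hη
  have hηp : 0 < η := by
    refine lt_min (by positivity) (lt_min (by positivity) (by positivity))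
  have hη1 : η ≤ c₀ / 4 := min_le_left _ _
  have hη2 : η ≤ omega β / (2 * 4 ^ β) := (min_le_right _ _).trans (min_le_left _ _)
  have hη3 : η ≤ 1 / (4 * N) := (min_le_right _ _).trans (min_le_right _ _)
  refine ⟨η, hηp, fun R Q₀ u B hB c hc k => ?_⟩
  induction k with
  | zero =>
    intro a l hl _
    rw [pow_zero, one_mul]
    exact (hausdorffContent_mono fun x hx => hx.1).trans (hausdorffContent_cube_le hβ R a hl)
  | succ k ih =>
    intro a l hl hQ
    have hlβ : 0 < l ^ β := Real.rpow_pos_of_pos hl _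
    set A : Set (E d) := {x ∈ cube R a l | B < |u x - c a l|} with hA
    have hAH : hausdorffContent β A ≤ ENNReal.ofReal (η * l ^ β) := by
      rw [ENNReal.ofReal_mul hηp.le]; exact hc a l hl hQ
    -- The factor 2 in `2 * η` supplies the strict inequality needed to pick a covering.
    obtain ⟨S, hS, hSw⟩ := exists_dyadic_cover R a hβ hl (b := ENNReal.ofReal (2 * η * l ^ β))
      (hAH.trans_lt ((ENNReal.ofReal_lt_ofReal_iff (by positivity)).2 (by nlinarith)))
      (by
        refine ENNReal.ofReal_le_ofReal ?_
        rw [Real.div_rpow hl.le (by norm_num)]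
        have : 2 * η ≤ omega β / 4 ^ β := by
          have h4 : (0 : ℝ) < 4 ^ β := by positivity
          rw [le_div_iff₀ (by positivity)] at hη2 ⊢
          linarith
        calc 2 * η * l ^ β ≤ omega β / 4 ^ β * l ^ β := by gcongr
          _ = _ := by ring)
    have hcell : ∀ s, hausdorffContent β (cell (dyadicIndex R a l) s) ≤
        ENNReal.ofReal C₂ * ENNReal.ofReal ((l / 2 ^ s.1) ^ β) := by
      intro s
      rw [cell_dyadicIndex R a hl]
      exact hausdorffContent_cube_le hβ R _ (by positivity)
    obtain ⟨T, _, g, hTc, hTs, hTw⟩ := exists_sparse_cover (nested_dyadicIndex R a (l := l))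
      (contentOuter d hβ) (w := fun k => ENNReal.ofReal ((l / 2 ^ k) ^ β))
      (C := ENNReal.ofReal C₂) (D := ENNReal.ofReal (2 ^ β)) (K := ENNReal.ofReal (2 / c₀))
      (by
        intro k
        rw [← ENNReal.ofReal_mul (by positivity), ← Real.mul_rpow (by norm_num) (by positivity)]
        refine ENNReal.ofReal_le_ofReal (le_of_eq ?_)
        congr 1; rw [pow_succ]; field_simp)
      hcell hS
      (by
        intro x _
        simp only [contentOuter_apply, pow_zero, div_one]
        calc ENNReal.ofReal (2 / c₀) * hausdorffContent β
              (A ∩ cell (dyadicIndex R a l) (lab (dyadicIndex R a l) 0 x))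
            ≤ ENNReal.ofReal (2 / c₀) * ENNReal.ofReal (η * l ^ β) := by
              gcongr
              exact (hausdorffContent_mono Set.inter_subset_left).trans hAH
          _ < ENNReal.ofReal (l ^ β) := by
              rw [← ENNReal.ofReal_mul (by positivity), ENNReal.ofReal_lt_ofReal_iff hlβ]
              have : 2 / c₀ * η < 1 := by
                rw [div_mul_eq_mul_div, div_lt_one hc₀p]; linarith
              nlinarith)
    have hTsub : ∀ t, cell (dyadicIndex R a l) (g t) ⊆ cube R a l := fun t =>
      cell_subset_of_nonempty R a hl ((hTs t).1.mono (by
        rintro x ⟨hx, hx'⟩; exact ⟨hx.1, hx'⟩))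
    -- The bad sets of `P` and of the large cube together have less content than `P`, so some point
    -- of `P` avoids both; there `u` is within `B` of each constant.
    have hclose : ∀ t, |c (dyadicCorner a l (g t)) (l / 2 ^ (g t).1) - c a l| ≤ 2 * B := by
      intro t
      set P := cell (dyadicIndex R a l) (g t) with hP
      set m : ℝ := (l / 2 ^ (g t).1) ^ β with hm
      have hmp : 0 < m := by positivity
      have hPc : P = cube R (dyadicCorner a l (g t)) (l / 2 ^ (g t).1) := cell_dyadicIndex R a hl _
      set c' := c (dyadicCorner a l (g t)) (l / 2 ^ (g t).1) with hc'
      set F : Set (E d) := {x ∈ P | B < |u x - c'|} with hF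
      have hFH : hausdorffContent β F ≤ ENNReal.ofReal (η * m) := by
        rw [ENNReal.ofReal_mul hηp.le, hF, hPc]
        exact hc _ _ (by positivity) (hPc ▸ (hTsub t).trans hQ)
      have hAP : hausdorffContent β (A ∩ P) ≤ ENNReal.ofReal (c₀ / 2 * m) := by
        have h1 := (hTs t).2.le
        rw [contentOuter_apply] at h1
        calc hausdorffContent β (A ∩ P) = ENNReal.ofReal (c₀ / 2) *
              (ENNReal.ofReal (2 / c₀) * hausdorffContent β (A ∩ P)) := by
              rw [← mul_assoc, ← ENNReal.ofReal_mul (by positivity)]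
              have : c₀ / 2 * (2 / c₀) = 1 := by field_simp
              rw [this]; simp
          _ ≤ ENNReal.ofReal (c₀ / 2) * ENNReal.ofReal m := by gcongr
          _ = _ := (ENNReal.ofReal_mul (by positivity)).symm
      have hPH : ENNReal.ofReal (c₀ * m) ≤ hausdorffContent β P := by
        rw [ENNReal.ofReal_mul hc₀p.le, hPc]
        exact le_hausdorffContent_cube hd hβ hβd R _ (by positivity)
      have hne : ¬ P ⊆ (A ∩ P) ∪ F := by
        intro hsub
        have h1 := (hausdorffContent_mono (β := β) hsub).trans
          (measure_union_le (μ := contentOuter d hβ) (A ∩ P) F)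
        have h2 := hPH.trans (h1.trans (add_le_add hAP hFH))
        rw [← ENNReal.ofReal_add (by positivity) (by positivity),
          ENNReal.ofReal_le_ofReal_iff (by positivity)] at h2
        nlinarith
      obtain ⟨x, hxP, hx⟩ := Set.not_subset.1 hne
      simp only [Set.mem_union, not_or] at hx
      have h1 : |u x - c a l| ≤ B := by
        by_contra h
        exact hx.1 ⟨⟨hTsub t hxP, not_le.1 h⟩, hxP⟩
      have h2 : |u x - c'| ≤ B := by
        by_contra h
        exact hx.2 ⟨hxP, not_le.1 h⟩
      rw [abs_le] at *
      constructor <;> linarith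
    have hTw' : ∑' t, ENNReal.ofReal ((l / 2 ^ (g t).1) ^ β) ≤
        ENNReal.ofReal (1 / 2) * ENNReal.ofReal (l ^ β) := by
      calc ∑' t, ENNReal.ofReal ((l / 2 ^ (g t).1) ^ β)
          ≤ (1 + ENNReal.ofReal (2 ^ β) * (ENNReal.ofReal (2 / c₀) * ENNReal.ofReal C₂)) *
            (ENNReal.ofReal (3 ^ d * (4 ^ β / omega β)) * ENNReal.ofReal (2 * η * l ^ β)) :=
            hTw.trans (by gcongr)
        _ = ENNReal.ofReal (N * (2 * η * l ^ β)) := by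
            rw [← ENNReal.ofReal_one, ← ENNReal.ofReal_mul (by positivity),
              ← ENNReal.ofReal_mul (by positivity), ← ENNReal.ofReal_add (by positivity)
              (by positivity), ← ENNReal.ofReal_mul (by positivity),
              ← ENNReal.ofReal_mul (by positivity), hN]
            congr 1; ring
        _ ≤ _ := by
            rw [← ENNReal.ofReal_mul (by positivity)]
            refine ENNReal.ofReal_le_ofReal ?_
            rw [le_div_iff₀ (by positivity)] at hη3
            nlinarith
    -- A point above level `2B(k+1)` lies in `A`, hence in a chosen cell, and changing the constant
    -- costs one step `2B`. The induction hypothesis then applies cell by cell.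
    have hsub : {x ∈ cube R a l | 2 * B * (k + 1 : ℕ) < |u x - c a l|} ⊆
        ⋃ t, {x ∈ cube R (dyadicCorner a l (g t)) (l / 2 ^ (g t).1) | 2 * B * k <
          |u x - c (dyadicCorner a l (g t)) (l / 2 ^ (g t).1)|} := by
      rintro x ⟨hxQ, hx⟩
      push_cast at hx
      have hxA : x ∈ A := ⟨hxQ, by
        have : 0 ≤ 2 * B * k := by positivity
        linarith⟩
      obtain ⟨t, ht⟩ := Set.mem_iUnion.1 (hTc hxA)
      refine Set.mem_iUnion.2 ⟨t, (cell_dyadicIndex R a hl (g t)) ▸ ht, ?_⟩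
      have h1 := hclose t
      have h2 := abs_sub_le (u x) (c (dyadicCorner a l (g t)) (l / 2 ^ (g t).1)) (c a l)
      linarith
    refine (hausdorffContent_mono hsub).trans
      ((measure_iUnion_le (μ := contentOuter d hβ) _).trans ?_)
    calc _ ≤ ∑' t, ENNReal.ofReal C₂ * (ENNReal.ofReal (1 / 2) ^ k *
          ENNReal.ofReal ((l / 2 ^ (g t).1) ^ β)) := by
          refine ENNReal.tsum_le_tsum fun t => ?_
          exact ih _ _ (by positivity) ((cell_dyadicIndex R a hl (g t)) ▸ (hTsub t).trans hQ)
      _ = ENNReal.ofReal C₂ * (ENNReal.ofReal (1 / 2) ^ k *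
          ∑' t, ENNReal.ofReal ((l / 2 ^ (g t).1) ^ β)) := by
          rw [ENNReal.tsum_mul_left, ENNReal.tsum_mul_left]
      _ ≤ _ := by
          rw [pow_succ, mul_assoc (ENNReal.ofReal (1 / 2) ^ k)]
          gcongr

/-! ### Choquet integrals of powers -/

theorem antitone_content_superlevel (A : Set (E d)) (f : E d → ℝ) :
    Antitone fun t : ℝ => hausdorffContent β {x ∈ A | t < f x} :=
  fun _ _ h => hausdorffContent_mono fun _ hx => ⟨hx.1, h.trans_lt hx.2⟩

/-- Chebyshev's inequality. -/
theorem ofReal_mul_content_le_choquetIntegral (A : Set (E d)) (f : E d → ℝ) (B : ℝ) :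
    ENNReal.ofReal B * hausdorffContent β {x ∈ A | B < f x} ≤ choquetIntegral β A f := by
  calc ENNReal.ofReal B * hausdorffContent β {x ∈ A | B < f x}
      = ∫⁻ _ in Set.Ioc (0 : ℝ) B, hausdorffContent β {x ∈ A | B < f x} := by
        rw [setLIntegral_const, Real.volume_Ioc, sub_zero, mul_comm]
    _ ≤ ∫⁻ t in Set.Ioc (0 : ℝ) B, hausdorffContent β {x ∈ A | t < f x} :=
        setLIntegral_mono' measurableSet_Ioc fun t ht =>
          antitone_content_superlevel A f ht.2
    _ ≤ _ := lintegral_mono_set Set.Ioc_subset_Ioi_self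

theorem choquetIntegral_le_add (A : Set (E d)) (f : E d → ℝ) {T : ℝ} (hT : 0 ≤ T) :
    choquetIntegral β A f ≤ (∫⁻ t in Set.Ioc 0 T, hausdorffContent β {x ∈ A | t < f x}) +
      ∫⁻ t in Set.Ioi T, hausdorffContent β {x ∈ A | t < f x} := by
  rw [choquetIntegral, ← Set.Ioc_union_Ioi_eq_Ioi hT]
  exact lintegral_union_le _ _ _

theorem lintegral_Ioi_sq_div {T : ℝ} (hT : 0 < T) :
    ∫⁻ t in Set.Ioi T, ENNReal.ofReal ((T / t) ^ 2) = ENNReal.ofReal T := by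
  have hcongr : ∀ t ∈ Set.Ioi T, ENNReal.ofReal ((T / t) ^ 2) =
      ENNReal.ofReal (T ^ 2 * t ^ (-2 : ℝ)) := by
    intro t ht
    have h0 : 0 < t := hT.trans ht
    congr 1
    rw [Real.rpow_neg h0.le, Real.rpow_two, div_pow, div_eq_mul_inv]
  rw [setLIntegral_congr_fun measurableSet_Ioi hcongr, ← ofReal_integral_eq_lintegral_ofReal]
  · rw [integral_const_mul, integral_Ioi_rpow_of_lt (by norm_num) hT]
    congr 1
    have : ((-2 : ℝ) + 1) = -1 := by norm_num
    rw [this, Real.rpow_neg_one]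
    field_simp
  · exact (integrableOn_Ioi_rpow_of_lt (by norm_num) hT).const_mul _
  · filter_upwards [ae_restrict_mem measurableSet_Ioi] with t ht
    have h0 : 0 < t := hT.trans ht
    simp only [Pi.zero_apply]
    positivity

/-- Exponential decay of the content of the superlevel sets bounds the Choquet integrals of
powers, with linear growth in the exponent of their `p`-th roots. -/
theorem choquetIntegral_rpow_le {A : Set (E d)} {f : E d → ℝ} (hf : ∀ x, 0 ≤ f x) {b p : ℝ}
    (hb : 0 < b) (hp : 1 ≤ p) {M : ℝ≥0∞}
    (h : ∀ k : ℕ, hausdorffContent β {x ∈ A | b * k < f x} ≤ M * ENNReal.ofReal (1 / 2) ^ k) :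
    choquetIntegral β A (fun x => f x ^ p) ≤
      M * ENNReal.ofReal (3 * (b * p / (Real.log 2 / 2)) ^ p) := by
  have hp0 : 0 < p := one_pos.trans_le hp
  have hlog : 0 < Real.log 2 := Real.log_pos (by norm_num)
  set a := Real.log 2 / 2 with ha
  have hap : 0 < a := by positivity
  -- Below `T` the trivial bound `M` gives `M * T`. Above `T`, half of the decay rate `log 2` gives
  -- `T / t`, so all of it gives the integrable `(T / t) ^ 2`, contributing `2 * M * T`.
  set T := (b * p / a) ^ p with hT
  have hTp : 0 < T := by positivity
  refine (choquetIntegral_le_add A _ hTp.le).trans ?_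
  have h1 : ∫⁻ t in Set.Ioc 0 T, hausdorffContent β {x ∈ A | t < f x ^ p} ≤
      M * ENNReal.ofReal T := by
    calc _ ≤ ∫⁻ _ in Set.Ioc 0 T, M := by
          refine setLIntegral_mono' measurableSet_Ioc fun t ht => ?_
          refine (hausdorffContent_mono ?_).trans ((h 0).trans_eq (by simp))
          rintro x ⟨hx, hxt⟩
          refine ⟨hx, ?_⟩
          rw [Nat.cast_zero, mul_zero]
          refine (hf x).lt_of_ne fun h0 => ?_
          rw [← h0, Real.zero_rpow hp0.ne'] at hxt
          exact absurd ht.1 hxt.not_gt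
      _ = _ := by rw [setLIntegral_const, Real.volume_Ioc, sub_zero]
  have h2 : ∫⁻ t in Set.Ioi T, hausdorffContent β {x ∈ A | t < f x ^ p} ≤
      M * ENNReal.ofReal (2 * T) := by
    calc _ ≤ ∫⁻ t in Set.Ioi T, M * ENNReal.ofReal 2 * ENNReal.ofReal ((T / t) ^ 2) := by
          refine setLIntegral_mono' measurableSet_Ioi fun t ht => ?_
          have ht0 : 0 < t := hTp.trans ht
          set s : ℝ := t ^ (1 / p) / b with hs
          have hs0 : 0 < s := by positivity
          set k := ⌊s⌋₊ with hk
          have hsub : {x ∈ A | t < f x ^ p} ⊆ {x ∈ A | b * k < f x} := by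
            rintro x ⟨hx, hxt⟩
            refine ⟨hx, ?_⟩
            have h3 : t ^ (1 / p) < f x := by
              have := Real.rpow_lt_rpow ht0.le hxt (by positivity : 0 < 1 / p)
              rwa [← Real.rpow_mul (hf x), mul_one_div_cancel hp0.ne', Real.rpow_one] at this
            calc b * k ≤ b * s := by gcongr; exact Nat.floor_le hs0.le
              _ = t ^ (1 / p) := by rw [hs]; field_simp
              _ < f x := h3
          refine (hausdorffContent_mono hsub).trans ((h k).trans ?_)
          rw [mul_assoc, ← ENNReal.ofReal_mul (by norm_num), ← ENNReal.ofReal_pow (by norm_num)]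
          gcongr
          have h4 : ((1 : ℝ) / 2) ^ k ≤ 2 * Real.exp (-(Real.log 2 * s)) := by
            have h5 : s < k + 1 := Nat.lt_floor_add_one s
            have h6 : ((1 : ℝ) / 2) ^ k = Real.exp (-(Real.log 2 * k)) := by
              rw [Real.exp_neg, mul_comm, Real.exp_nat_mul, Real.exp_log (by norm_num), one_div,
                inv_pow]
            have h7 : (2 : ℝ) = Real.exp (Real.log 2) := (Real.exp_log (by norm_num)).symm
            rw [h6]
            nth_rewrite 2 [h7]
            rw [← Real.exp_add]
            refine Real.exp_le_exp.2 ?_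
            nlinarith
          refine h4.trans ?_
          gcongr
          -- This is `y ≤ exp y` at `y = a * s / p`, raised to the power `p`; `T` was chosen so that
          -- `y ^ p = t / T`.
          have h8 : t / T ≤ Real.exp (a * s) := by
            have h9 : a * s / p ≤ Real.exp (a * s / p) := by
              linarith [Real.add_one_le_exp (a * s / p)]
            have h10 := Real.rpow_le_rpow (by positivity) h9 hp0.le
            rw [← Real.exp_mul, div_mul_cancel₀ _ hp0.ne'] at h10
            refine le_trans (le_of_eq ?_) h10
            have h11 : a * s / p = t ^ (1 / p) / (b * p / a) := by rw [hs]; field_simp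
            rw [h11, Real.div_rpow (by positivity) (by positivity), ← Real.rpow_mul ht0.le,
              one_div_mul_cancel hp0.ne', Real.rpow_one]
          have h12 : Real.exp (-(Real.log 2 * s)) = (Real.exp (a * s))⁻¹ ^ 2 := by
            rw [← Real.exp_neg, ← Real.exp_nat_mul]
            congr 1; rw [ha]; push_cast; ring
          rw [h12, ← inv_div t T]
          gcongr
      _ = M * ENNReal.ofReal 2 * ENNReal.ofReal T := by
          rw [lintegral_const_mul _ (by fun_prop), lintegral_Ioi_sq_div hTp]
      _ = _ := by rw [mul_assoc, ← ENNReal.ofReal_mul (by norm_num)]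
  refine (add_le_add h1 h2).trans_eq ?_
  rw [← mul_add, ← ENNReal.ofReal_add (by positivity) (by positivity)]
  congr 2; ring

/-- A substitute for Hölder's inequality. -/
theorem choquetIntegral_le_rpow {A : Set (E d)} {f : E d → ℝ} {m p : ℝ}
    (hm : 0 < m) (hp : 1 ≤ p) :
    choquetIntegral β A f ≤ ENNReal.ofReal m * hausdorffContent β A +
      ENNReal.ofReal (m ^ (1 - p)) * choquetIntegral β A (fun x => f x ^ p) := by
  refine (choquetIntegral_le_add A _ hm.le).trans (add_le_add ?_ ?_)
  · calc _ ≤ ∫⁻ _ in Set.Ioc 0 m, hausdorffContent β A :=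
          lintegral_mono fun t => hausdorffContent_mono fun x hx => hx.1
      _ = _ := by rw [setLIntegral_const, Real.volume_Ioc, sub_zero, mul_comm]
  -- If `f x > t > m` then `f x ^ p > c * t`; rescaling `t` by `c` produces the factor `m ^ (1 -
  -- p)`.
  · set c : ℝ := m ^ (p - 1) with hc
    have hcp : 0 < c := by positivity
    set G : ℝ → ℝ≥0∞ := fun t => hausdorffContent β {x ∈ A | t < f x ^ p} with hG
    have hGm : Measurable G := (antitone_content_superlevel A _).measurable
    calc ∫⁻ t in Set.Ioi m, hausdorffContent β {x ∈ A | t < f x}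
        ≤ ∫⁻ t in Set.Ioi m, G (c * t) := by
          refine setLIntegral_mono' measurableSet_Ioi fun t ht => hausdorffContent_mono ?_
          rintro x ⟨hx, hxt⟩
          refine ⟨hx, ?_⟩
          have h0 : 0 < f x := hm.trans (ht.trans hxt)
          calc c * t < c * f x := by gcongr
            _ ≤ f x ^ (p - 1) * f x := by
                gcongr
                exact Real.rpow_le_rpow hm.le (ht.trans hxt).le (by linarith)
            _ = f x ^ p := by
                rw [← Real.rpow_add_one h0.ne']; simp
      _ ≤ ∫⁻ t in (fun t => c * t) ⁻¹' Set.Ioi 0, G (c * t) := by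
          refine lintegral_mono_set fun t ht => ?_
          exact mul_pos hcp (hm.trans ht)
      _ = ∫⁻ t in Set.Ioi 0, G t ∂(Measure.map (fun t => c * t) volume) :=
          (setLIntegral_map measurableSet_Ioi hGm (measurable_const_mul c)).symm
      _ = ENNReal.ofReal c⁻¹ * ∫⁻ t in Set.Ioi 0, G t := by
          rw [Real.map_volume_mul_left hcp.ne', Measure.restrict_smul, lintegral_smul_measure,
            abs_of_pos (by positivity), smul_eq_mul]
      _ = _ := by
          rw [hc, ← Real.rpow_neg hm.le, neg_sub]; rfl

/-! ### Comparison of the seminorms -/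

theorem bmoSeminorm_le_bmoSeminormP (hβ : 0 < β) {R : E d ≃ₗᵢ[ℝ] E d} {Q₀ : Set (E d)} {p : ℝ}
    (hp : 1 ≤ p) (u : E d → ℝ) :
    bmoSeminorm β R Q₀ u ≤
      ENNReal.ofReal (omega β * (d + 1) ^ β + 1) * bmoSeminormP β p R Q₀ u := by
  have hω := omega_pos hβ
  have hp0 : 0 < p := one_pos.trans_le hp
  have hK : 0 < omega β * (d + 1) ^ β + 1 := by positivity
  rw [mul_comm, ← ENNReal.div_le_iff (ENNReal.ofReal_pos.2 hK).ne' ENNReal.ofReal_ne_top]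
  -- Any `M` strictly above the seminorm is positive, even when the seminorm vanishes, and admits on
  -- each subcube a constant `c` that beats it. Truncating at height `M` then balances the two
  -- terms.
  refine le_of_forall_gt_imp_ge_of_dense fun M hM => ?_
  rw [ENNReal.div_le_iff (ENNReal.ofReal_pos.2 hK).ne' ENNReal.ofReal_ne_top]
  rcases eq_or_ne M ∞ with rfl | hMt
  · rw [ENNReal.top_mul (ENNReal.ofReal_pos.2 hK).ne']; exact le_top
  lift M to ℝ≥0 using hMt
  have hM0 : 0 < (M : ℝ) := by exact_mod_cast (zero_le.trans_lt hM : (0 : ℝ≥0∞) < M)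
  refine iSup_le fun a => iSup_le fun l => iSup_le fun hl => iSup_le fun hQ => ?_
  have hlβ : 0 < l ^ β := Real.rpow_pos_of_pos hl _
  have h1 : (⨅ c : ℝ, (choquetIntegral β (cube R a l) (fun x => |u x - c| ^ p) /
      ENNReal.ofReal (l ^ β)) ^ (1 / p)) < M :=
    lt_of_le_of_lt (le_iSup_of_le a (le_iSup_of_le l (le_iSup_of_le hl
        (le_iSup (fun _ : cube R a l ⊆ Q₀ => _) hQ)))) hM
  obtain ⟨c, hc⟩ := iInf_lt_iff.1 h1
  refine iInf_le_of_le c ?_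
  rw [ENNReal.div_le_iff (ENNReal.ofReal_pos.2 hlβ).ne' ENNReal.ofReal_ne_top]
  have h2 : choquetIntegral β (cube R a l) (fun x => |u x - c| ^ p) ≤
      ENNReal.ofReal ((M : ℝ) ^ p * l ^ β) := by
    rw [one_div, ENNReal.rpow_inv_lt_iff hp0, ENNReal.div_lt_iff
      (Or.inl (ENNReal.ofReal_pos.2 hlβ).ne') (Or.inl ENNReal.ofReal_ne_top)] at hc
    refine hc.le.trans_eq ?_
    rw [ENNReal.ofReal_mul (by positivity), ← ENNReal.ofReal_rpow_of_nonneg hM0.le hp0.le,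
      ENNReal.ofReal_coe_nnreal]
  refine (choquetIntegral_le_rpow hM0 hp).trans ?_
  calc _ ≤ ENNReal.ofReal M * (ENNReal.ofReal (omega β * (d + 1) ^ β) * ENNReal.ofReal (l ^ β)) +
        ENNReal.ofReal ((M : ℝ) ^ (1 - p)) * ENNReal.ofReal ((M : ℝ) ^ p * l ^ β) := by
        gcongr
        exact hausdorffContent_cube_le hβ R a hl
    _ = ENNReal.ofReal (M * (omega β * (d + 1) ^ β + 1) * l ^ β) := by
        rw [← ENNReal.ofReal_mul (by positivity), ← ENNReal.ofReal_mul (by positivity),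
          ← ENNReal.ofReal_mul (by positivity), ← ENNReal.ofReal_add (by positivity)
          (by positivity), ← mul_assoc ((M : ℝ) ^ (1 - p)), ← Real.rpow_add hM0]
        simp only [sub_add_cancel, Real.rpow_one]
        congr 1; ring
    _ = _ := by
        rw [ENNReal.ofReal_mul (by positivity), ENNReal.ofReal_mul (by positivity),
          ENNReal.ofReal_coe_nnreal]

/-- The John–Nirenberg estimate for the seminorms. -/
theorem exists_bmoSeminormP_le (hd : 0 < d) (hβ : 0 < β) (hβd : β ≤ d) :
    ∃ C : ℝ, 0 < C ∧ ∀ (R : E d ≃ₗᵢ[ℝ] E d) (Q₀ : Set (E d)) (p : ℝ), 1 ≤ p →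
      ∀ u : E d → ℝ,
        bmoSeminormP β p R Q₀ u ≤ ENNReal.ofReal (C * p) * bmoSeminorm β R Q₀ u := by
  have hω := omega_pos hβ
  obtain ⟨η, hη, hdecay⟩ := exists_threshold_decay hd hβ hβd
  have hlog : 0 < Real.log 2 / 2 := by have := Real.log_pos (x := 2) (by norm_num); positivity
  -- Since `N ≥ 1`, the constant `3 * omega β * (d + 1) ^ β` is at most `N ≤ N ^ p`; its `p`-th root
  -- is thus bounded independently of `p`.
  set N : ℝ := 1 + omega β * (d + 1) ^ β * 3 with hN
  have hN1 : 1 ≤ N := by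
    have : 0 ≤ omega β * (d + 1) ^ β * 3 := by positivity
    linarith
  have hN0 : 0 < N := by linarith
  refine ⟨N * (2 / η / (Real.log 2 / 2)), by positivity, fun R Q₀ p hp u => ?_⟩
  have hp0 : 0 < p := one_pos.trans_le hp
  have hK : 0 < N * (2 / η / (Real.log 2 / 2)) * p := by positivity
  rw [mul_comm (ENNReal.ofReal _), ← ENNReal.div_le_iff (ENNReal.ofReal_pos.2 hK).ne'
    ENNReal.ofReal_ne_top]
  refine le_of_forall_gt_imp_ge_of_dense fun M hM => ?_
  rw [ENNReal.div_le_iff (ENNReal.ofReal_pos.2 hK).ne' ENNReal.ofReal_ne_top]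
  rcases eq_or_ne M ∞ with rfl | hMt
  · rw [ENNReal.top_mul (ENNReal.ofReal_pos.2 hK).ne']; exact le_top
  lift M to ℝ≥0 using hMt
  have hM0 : 0 < (M : ℝ) := by exact_mod_cast (zero_le.trans_lt hM : (0 : ℝ≥0∞) < M)
  have hex : ∀ (a : E d) (l : ℝ), 0 < l → cube R a l ⊆ Q₀ → ∃ c : ℝ,
      choquetIntegral β (cube R a l) (fun x => |u x - c|) ≤ ENNReal.ofReal (M * l ^ β) := by
    intro a l hl hQ
    have hlβ : 0 < l ^ β := Real.rpow_pos_of_pos hl _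
    have h1 : (⨅ c : ℝ, choquetIntegral β (cube R a l) (fun x => |u x - c|) /
        ENNReal.ofReal (l ^ β)) < M :=
      lt_of_le_of_lt (le_iSup_of_le a (le_iSup_of_le l (le_iSup_of_le hl
        (le_iSup (fun _ : cube R a l ⊆ Q₀ => _) hQ)))) hM
    obtain ⟨c, hc⟩ := iInf_lt_iff.1 h1
    refine ⟨c, ?_⟩
    rw [ENNReal.div_lt_iff (Or.inl (ENNReal.ofReal_pos.2 hlβ).ne')
      (Or.inl ENNReal.ofReal_ne_top)] at hc
    rw [ENNReal.ofReal_mul hM0.le, ENNReal.ofReal_coe_nnreal]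
    exact hc.le
  choose! c hc using hex
  -- With this level Chebyshev gives relative content exactly `M / B = η`.
  set B : ℝ := M / η with hB
  have hB0 : 0 < B := by positivity
  have hdec := hdecay R Q₀ u B hB0 c (by
    intro a l hl hQ
    have h1 := (ofReal_mul_content_le_choquetIntegral (β := β) (cube R a l)
      (fun x => |u x - c a l|) B).trans (hc a l hl hQ)
    have h2 : ENNReal.ofReal (M * l ^ β) =
        ENNReal.ofReal B * (ENNReal.ofReal η * ENNReal.ofReal (l ^ β)) := by
      rw [← ENNReal.ofReal_mul hη.le, ← ENNReal.ofReal_mul hB0.le, hB]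
      congr 1; field_simp
    rw [h2] at h1
    exact (ENNReal.mul_le_mul_iff_right (ENNReal.ofReal_pos.2 hB0).ne' ENNReal.ofReal_ne_top).1 h1)
  refine iSup_le fun a => iSup_le fun l => iSup_le fun hl => iSup_le fun hQ => ?_
  have hlβ : 0 < l ^ β := Real.rpow_pos_of_pos hl _
  refine iInf_le_of_le (c a l) ?_
  have hint := choquetIntegral_rpow_le (β := β) (A := cube R a l) (f := fun x => |u x - c a l|)
    (fun x => abs_nonneg _) (b := 2 * B) (by positivity) hp
    (M := ENNReal.ofReal (omega β * (d + 1) ^ β * l ^ β)) (by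
      intro k
      refine (hdec k a l hl hQ).trans_eq ?_
      rw [ENNReal.ofReal_mul (p := omega β * (d + 1) ^ β) (by positivity)]
      ring)
  have hbound : choquetIntegral β (cube R a l) (fun x => |u x - c a l| ^ p) /
      ENNReal.ofReal (l ^ β) ≤ ENNReal.ofReal ((N * (2 * B * p / (Real.log 2 / 2))) ^ p) := by
    rw [ENNReal.div_le_iff (ENNReal.ofReal_pos.2 hlβ).ne' ENNReal.ofReal_ne_top,
      ← ENNReal.ofReal_mul (by positivity)]
    refine hint.trans ?_
    rw [← ENNReal.ofReal_mul (by positivity)]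
    refine ENNReal.ofReal_le_ofReal ?_
    rw [Real.mul_rpow hN0.le (by positivity)]
    have h1 : omega β * (d + 1) ^ β * 3 ≤ N ^ p := by
      refine le_trans ?_ (Real.self_le_rpow_of_one_le hN1 hp)
      linarith
    calc omega β * (d + 1) ^ β * l ^ β * (3 * (2 * B * p / (Real.log 2 / 2)) ^ p)
        = omega β * (d + 1) ^ β * 3 * (2 * B * p / (Real.log 2 / 2)) ^ p * l ^ β := by ring
      _ ≤ _ := by gcongr
  refine (ENNReal.rpow_le_rpow hbound (by positivity)).trans_eq ?_
  rw [ENNReal.ofReal_rpow_of_nonneg (by positivity) (by positivity), ← Real.rpow_mul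
    (by positivity), mul_one_div_cancel hp0.ne', Real.rpow_one, ← ENNReal.ofReal_coe_nnreal,
    ← ENNReal.ofReal_mul hM0.le, hB]
  congr 1; ring

end ChoquetBMO

end

theorem corollary1p5 (d : ℕ) (β : ℝ) (hβ : 0 < β) (hβd : β ≤ d) :
    ∃ C : ℝ, 0 < C ∧
      ∀ (R : ChoquetBMO.E d ≃ₗᵢ[ℝ] ChoquetBMO.E d) (Q₀ : Set (ChoquetBMO.E d)),
        ChoquetBMO.IsCube R Q₀ →
        ∀ p : ℝ, 1 ≤ p →
        ∀ u : ChoquetBMO.E d → ℝ, ChoquetBMO.MemBMO β R Q₀ u →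
          ENNReal.ofReal (1 / C) * ChoquetBMO.bmoSeminorm β R Q₀ u
              ≤ ChoquetBMO.bmoSeminormP β p R Q₀ u ∧
          ChoquetBMO.bmoSeminormP β p R Q₀ u
              ≤ ENNReal.ofReal (C * p) * ChoquetBMO.bmoSeminorm β R Q₀ u := by
  have hω := ChoquetBMO.omega_pos hβ
  have hd : 0 < d := by exact_mod_cast hβ.trans_le hβd
  obtain ⟨C, hC, hup⟩ := ChoquetBMO.exists_bmoSeminormP_le hd hβ hβd
  have hK : 0 < ChoquetBMO.omega β * (d + 1) ^ β + 1 := by positivity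
  refine ⟨max C (ChoquetBMO.omega β * (d + 1) ^ β + 1), lt_max_of_lt_left hC,
    fun R Q₀ _ p hp u _ => ⟨?_, ?_⟩⟩
  · calc _ ≤ ENNReal.ofReal (1 / (ChoquetBMO.omega β * (d + 1) ^ β + 1)) *
          (ENNReal.ofReal (ChoquetBMO.omega β * (d + 1) ^ β + 1) *
            ChoquetBMO.bmoSeminormP β p R Q₀ u) := by
          gcongr
          · exact le_max_right _ _
          · exact ChoquetBMO.bmoSeminorm_le_bmoSeminormP hβ hp u
      _ = _ := by
          rw [← mul_assoc, ← ENNReal.ofReal_mul (by positivity), one_div_mul_cancel hK.ne',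
            ENNReal.ofReal_one, one_mul]
  · refine (hup R Q₀ p hp u).trans ?_
    gcongr
    exact le_max_left _ _
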